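/- Let $\mathcal S\subseteq\mathbb R^d$ and $\mathcal A\subseteq\mathbb R^m$ be open, and consider the controlled diffusion $ds_t=b(s_t,a_t)\,dt+\Sigma(s_t,a_t)\,dW_t$ with reward $r$, where $b:\mathcal S\times\mathcal A\to\mathbb R^d$, $\Sigma:\mathcal S\times\mathcal A\to\mathbb R^{d\times q}$ and $r:\mathcal S\times\mathcal A\to\mathbb R$. Put $Q=\Sigma\Sigma^\top$ and $$(\mathcal L^af)(s)=b(s,a)\cdot\nabla f(s)+\tfrac12\operatorname{tr}\bigl(Q(s,a)\nabla^2f(s)\bigr).$$ Assume that $b,Q,r$ are smooth on $\mathcal S\times\mathcal A$. Let $X$ and $Y$ be smooth vector fields on $\mathcal S$ and $\mathcal A$, and let $\Omega\subseteq\mathcal S\times\mathcal A$ be an open set on which the determining equations hold: $$X\cdot\nabla_s r+Y\cdot\nabla_a r=0,$$ $$(\nabla_s b)X-(\nabla_sX)b+(\nabla_a b)Y-\tfrac12\Delta_QX=0,\qquad (\Delta_QX)_k=\operatorname{tr}(Q\nabla_s^2X_k),$$ $$\nabla_sQ[X]-(\nabla_sX)Q-Q(\nabla_sX)^\top+\nabla_aQ[Y]=0.$$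 Let $\varepsilon_0>0$, and let $U\subseteq\mathcal S$, $V\subseteq\mathcal A$ be open sets with $\Omega\subseteq U\times V$ (for example $U=\mathcal S$, $V=\mathcal A$). Assume that the flows $g_\varepsilon:U\to\mathcal S$ and $h_\varepsilon:V\to\mathcal A$ of $X$ and $Y$, i.e. $\frac{d}{d\varepsilon}g_\varepsilon(s)=X(g_\varepsilon(s))$, $g_0(s)=s$ and $\frac{d}{d\varepsilon}h_\varepsilon(a)=Y(h_\varepsilon(a))$, $h_0(a)=a$, exist for $|\varepsilon|<\varepsilon_0$ and that each $g_\varepsilon$ and each $h_\varepsilon$ is a smooth diffeomorphism onto its open image. Say that $(g_\varepsilon,h_\varepsilon)$ is exactly value-preserving on a set $W\subseteq U\times V$ if for all $(s,a)\in W$ and all $f\in C^2(\mathcal S)$ $$\bigl(\mathcal L^a(f\circ g_\varepsilon)\bigr)(s)=\bigl(\mathcal L^{h_\varepsilon(a)}f\bigr)(g_\varepsilon(s))\qquad\text{and}\qquad r(g_\varepsilon(s),h_\varepsilon(a))=r(s,a).$$ Then: 1. For every $|\varepsilon|<\varepsilon_0$, $(g_\varepsilon,h_\varepsilon)$ is exactly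 value-preserving on the set of those $(s,a)\in\Omega$ for which $(g_\tau(s),h_\tau(a))\in\Omega$ for all $\tau$ between $0$ and $\varepsilon$. 2. For every compact $K\subseteq\Omega$ there is $\delta\in(0,\varepsilon_0]$ such that $(g_\varepsilon,h_\varepsilon)$ is exactly value-preserving on $K$ for all $|\varepsilon|<\delta$. 3. If $(g_\varepsilon(s),h_\varepsilon(a))\in\Omega$ for all $(s,a)\in\Omega$ and $|\varepsilon|<\varepsilon_0$, then $(g_\varepsilon,h_\varepsilon)$ is exactly value-preserving on all of $\Omega$ for every $|\varepsilon|<\varepsilon_0$. -/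

import Mathlib

open Set
open scoped ContDiff

noncomputable section

namespace VPS

/-- Euclidean space `ℝⁿ`. -/
abbrev E (n : ℕ) := EuclideanSpace ℝ (Fin n)

/-- The Hessian matrix `(∂ᵢ ∂ⱼ f)(x)`. -/
def hess {n : ℕ} (f : E n → ℝ) (x : E n) : Matrix (Fin n) (Fin n) ℝ :=
  Matrix.of fun i j =>
    fderiv ℝ (fun y => fderiv ℝ f y (EuclideanSpace.single j 1)) x (EuclideanSpace.single i 1)

/-- The Jacobian matrix `(∂ⱼ Xᵢ)(x)` of a vector field. -/
def jac {n : ℕ} (X : E n → E n) (x : E n) : Matrix (Fin n) (Fin n) ℝ :=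
  Matrix.of fun i j => fderiv ℝ X x (EuclideanSpace.single j 1) i

/-- The second-order operator `Δ_Q X = (tr (Q ∇² X₁), …, tr (Q ∇² Xₙ))`. -/
def secondOrder {n : ℕ} (Q : Matrix (Fin n) (Fin n) ℝ) (X : E n → E n) (x : E n) : E n :=
  WithLp.toLp 2 fun k => (Q * hess (fun y => X y k) x).trace

/-- The data of a controlled Itô diffusion `ds = b(s,a) dt + σ(s,a) dW` with reward `r(s,a)`:
states in `ℝᵈ`, actions in `ℝᵐ`, and a `q`-dimensional Brownian motion. Only the values at states
and actions in the (open) state and action spaces matter. -/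
structure ControlledDiffusion (d m q : ℕ) where
  /-- drift -/
  b : E d → E m → E d
  /-- diffusion coefficient -/
  σ : E d → E m → Matrix (Fin d) (Fin q) ℝ
  /-- reward -/
  r : E d → E m → ℝ

namespace ControlledDiffusion

variable {d m q : ℕ} (D : ControlledDiffusion d m q)

/-- The diffusion matrix `Q = σ σᵀ`. -/
def Q (s : E d) (a : E m) : Matrix (Fin d) (Fin d) ℝ :=
  D.σ s a * (D.σ s a).transpose

/-- The controlled generator `(Lᵃ f)(s) = b(s,a) · ∇f(s) + ½ tr (Q(s,a) ∇²f(s))`. -/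
def generator (a : E m) (f : E d → ℝ) (s : E d) : ℝ :=
  inner ℝ (D.b s a) (gradient f s) + (1 / 2) * (D.Q s a * hess f s).trace

/-- `b`, `Q` and `r` are smooth on (state space) × (action space). -/
def SmoothOn (S : Set (E d)) (A : Set (E m)) : Prop :=
  ContDiffOn ℝ ∞ (fun p : E d × E m => D.b p.1 p.2) (S ×ˢ A) ∧
  (∀ i j, ContDiffOn ℝ ∞ (fun p : E d × E m => D.Q p.1 p.2 i j) (S ×ˢ A)) ∧
  ContDiffOn ℝ ∞ (fun p : E d × E m => D.r p.1 p.2) (S ×ˢ A)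

/-- The reward equation `X · ∇ₛ r + Y · ∇ₐ r = 0` at `(s, a)`. -/
def RewardEq (X : E d → E d) (Y : E m → E m) (s : E d) (a : E m) : Prop :=
  inner ℝ (X s) (gradient (fun s' => D.r s' a) s) +
    inner ℝ (Y a) (gradient (fun a' => D.r s a') a) = 0

/-- The drift equation `(∇ₛ b) X - (∇ₛ X) b + (∇ₐ b) Y - ½ Δ_Q X = 0` at `(s, a)`. -/
def DriftEq (X : E d → E d) (Y : E m → E m) (s : E d) (a : E m) : Prop :=
  fderiv ℝ (fun s' => D.b s' a) s (X s) - fderiv ℝ X s (D.b s a) +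
    fderiv ℝ (fun a' => D.b s a') a (Y a) -
    (1 / 2 : ℝ) • secondOrder (D.Q s a) X s = 0

/-- The diffusion equation `∇ₛ Q [X] - (∇ₛ X) Q - Q (∇ₛ X)ᵀ + ∇ₐ Q [Y] = 0` at `(s, a)`;
directional derivatives of the matrix field are taken entry by entry. -/
def DiffusionEq (X : E d → E d) (Y : E m → E m) (s : E d) (a : E m) : Prop :=
  (Matrix.of fun i j => fderiv ℝ (fun s' => D.Q s' a i j) s (X s)) -
    jac X s * D.Q s a - D.Q s a * (jac X s).transpose +
    (Matrix.of fun i j => fderiv ℝ (fun a' => D.Q s a' i j) a (Y a)) = 0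

/-- `X` and `Y` satisfy the three determining equations on `Ω`. -/
def DeterminingEqsOn (X : E d → E d) (Y : E m → E m) (Ω : Set (E d × E m)) : Prop :=
  ∀ p ∈ Ω, D.RewardEq X Y p.1 p.2 ∧ D.DriftEq X Y p.1 p.2 ∧ D.DiffusionEq X Y p.1 p.2

/-- The pair `(g, h)` satisfies the conditions of an exact value-preserving structure at all points
of `W`: for every `f ∈ C²(S)`, `Lᵃ (f ∘ g) = (L^{h(a)} f) ∘ g`, and `r (g s, h a) = r (s, a)`. -/
def ExactValuePreservingOn (S : Set (E d)) (W : Set (E d × E m))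
    (g : E d → E d) (h : E m → E m) : Prop :=
  (∀ f : E d → ℝ, ContDiffOn ℝ 2 f S → ∀ p ∈ W,
    D.generator p.2 (f ∘ g) p.1 = D.generator (h p.2) f (g p.1)) ∧
  ∀ p ∈ W, D.r (g p.1) (h p.2) = D.r p.1 p.2

end ControlledDiffusion

/-- `φ` is a smooth diffeomorphism from the open set `U` onto the open set `φ(U)`. -/
def IsDiffeoOnImage {n : ℕ} (φ : E n → E n) (U : Set (E n)) : Prop :=
  IsOpen (φ '' U) ∧ ContDiffOn ℝ ∞ φ U ∧
    ∃ ψ : E n → E n, ContDiffOn ℝ ∞ ψ (φ '' U) ∧ LeftInvOn ψ φ U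

/-- `g` is the flow on `U`, in the space `S`, of the vector field `X` for times `|ε| < ε₀`, and its
time-`ε` maps are diffeomorphisms onto their images. (For `U = S` each of them then maps `S` onto
`S`, because its inverse is the time-`-ε` map.) -/
structure IsDiffeoFlow {n : ℕ} (X : E n → E n) (S U : Set (E n)) (ε₀ : ℝ)
    (g : ℝ → E n → E n) : Prop where
  zero : ∀ s ∈ U, g 0 s = s
  mem : ∀ ε, |ε| < ε₀ → ∀ s ∈ U, g ε s ∈ S
  ode : ∀ ε, |ε| < ε₀ → ∀ s ∈ U, HasDerivAt (fun τ => g τ s) (X (g ε s)) ε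
  diffeo : ∀ ε, |ε| < ε₀ → IsDiffeoOnImage (g ε) U

/-- The points of `Ω` whose orbit segment between times `0` and `ε` stays in `Ω`. -/
def staysIn {d m : ℕ} (Ω : Set (E d × E m)) (g : ℝ → E d → E d) (h : ℝ → E m → E m) (ε : ℝ) :
    Set (E d × E m) :=
  {p | p ∈ Ω ∧ ∀ τ ∈ uIcc 0 ε, (g τ p.1, h τ p.2) ∈ Ω}

end VPS

end

/-!
Fix `(s, a)` and follow its orbit `(g τ s, h τ a)`. The reward is constant along it because the
reward equation says that its derivative vanishes. For the generator, write `Q(s, a) = ∑ₖ vₖ vₖᵀ`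
with `vₖ` the columns of `σ(s, a)`, so that `tr (Q ∇²f) = ∑ₖ D²f (vₖ, vₖ)`. By the second-order
chain rule, the identity `Lᵃ (f ∘ g) = (L^{h(a)} f) ∘ g` at `(s, a)` follows from
* `Q (g s, h a) = ∑ₖ wₖ wₖᵀ` with `wₖ = Dg(s) vₖ` (`Q_flow`), and
* `b (g s, h a) = Dg(s) b(s, a) + ½ ∑ₖ D²g(s) (vₖ, vₖ)` (`b_flow`).

Both hold at time `0`. Along the orbit, the diffusion equation shows that the difference `R` of
the two sides of the first solves `R' = (∇X) R + R (∇X)ᵀ`, and the drift equation, given the first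
identity, that the difference `P` of the two sides of the second solves `P' = (∇X) P`. By
Grönwall's inequality both vanish as long as the orbit stays in `Ω`.

Differentiating `Dg(s) v` and `D²g(s) (v, v)` in time requires the first two variational
equations. Each flow map is smooth by assumption, but joint smoothness in time and space is not
assumed. `hasDerivAt_of_hasDerivAt_param` derives the linearized equation for any one-parameter
family of solutions that is differentiable in the parameter at each time. Applied to `t ↦ g τ (s +
t v)`, and then to the flow induced on the tangent bundle, it gives both equations.

The statement on compact sets follows from joint continuity of the flows at time `0`.
-/

noncomputable section

open Filter Topology

/-! ### Families of solutions of ordinary differential equations -/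

section ODE

variable {F : Type*} [NormedAddCommGroup F] [NormedSpace ℝ F]

/-- Grönwall's inequality, in either direction of time. -/
theorem norm_le_exp_mul_of_norm_deriv_le {y y' : ℝ → F} {t₀ t K : ℝ}
    (hy : ∀ u ∈ uIcc t₀ t, HasDerivAt y (y' u) u)
    (hK : ∀ u ∈ uIcc t₀ t, ‖y' u‖ ≤ K * ‖y u‖) :
    ‖y t‖ ≤ Real.exp (K * |t - t₀|) * ‖y t₀‖ := by
  have key : ∀ {z z' : ℝ → F} {a b : ℝ}, a ≤ b → (∀ u ∈ Icc a b, HasDerivAt z (z' u) u) →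
      (∀ u ∈ Icc a b, ‖z' u‖ ≤ K * ‖z u‖) → ‖z b‖ ≤ Real.exp (K * (b - a)) * ‖z a‖ := by
    intro z z' a b hab hz hb
    have := norm_le_gronwallBound_of_norm_deriv_right_le (f := z) (f' := z') (δ := ‖z a‖) (K := K)
      (ε := 0) (a := a) (b := b) (fun u hu => (hz u hu).continuousAt.continuousWithinAt)
      (fun u hu => (hz u (Ico_subset_Icc_self hu)).hasDerivWithinAt) le_rfl
      (fun u hu => by simpa using hb u (Ico_subset_Icc_self hu)) b (right_mem_Icc.2 hab)
    rwa [gronwallBound_ε0, mul_comm] at this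
  rcases le_total t₀ t with h | h
  · rw [uIcc_of_le h] at hy hK
    rw [abs_of_nonneg (sub_nonneg.2 h)]
    exact key h hy hK
  · rw [uIcc_of_ge h] at hy hK
    have := key (z := fun u => y (-u)) (z' := fun u => -y' (-u)) (neg_le_neg h)
      (fun u hu => by
        have hu' : -u ∈ Icc t t₀ := ⟨by linarith [hu.2], by linarith [hu.1]⟩
        simpa [Function.comp_def] using (hy (-u) hu').scomp u (hasDerivAt_neg u))
      (fun u hu => by simpa using hK (-u) ⟨by linarith [hu.2], by linarith [hu.1]⟩)
    rw [abs_of_nonpos (sub_nonpos.2 h)]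
    simpa [sub_eq_add_neg, add_comm] using this

/-- A curve whose speed is less than `M` as long as it stays within distance `r` of `x₀` cannot
leave that ball before time `(r - ρ) / M`, if it starts within distance `ρ`. -/
theorem norm_sub_le_of_norm_deriv_lt {y y' : ℝ → F} {x₀ : F} {t₀ t ρ r M : ℝ}
    (hy : ∀ u ∈ uIcc t₀ t, HasDerivAt y (y' u) u)
    (hM : ∀ u ∈ uIcc t₀ t, ‖y u - x₀‖ ≤ r → ‖y' u‖ < M) (hM0 : 0 ≤ M)
    (h₀ : ‖y t₀ - x₀‖ ≤ ρ) (hr : ρ + M * |t - t₀| ≤ r) : ‖y t - x₀‖ ≤ r := by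
  have key : ∀ {z z' : ℝ → F} {a b : ℝ}, a ≤ b → (∀ u ∈ Icc a b, HasDerivAt z (z' u) u) →
      (∀ u ∈ Icc a b, ‖z u - x₀‖ ≤ r → ‖z' u‖ < M) → ‖z a - x₀‖ ≤ ρ → ρ + M * (b - a) ≤ r →
      ‖z b - x₀‖ ≤ r := by
    intro z z' a b hab hz hb ha hr
    refine (image_norm_le_of_norm_deriv_right_lt_deriv_boundary (f := fun u => z u - x₀)
      (f' := z') (B := fun u => ρ + M * (u - a)) (B' := fun _ => M) (a := a) (b := b)
      (fun u hu => ((hz u hu).sub_const x₀).continuousAt.continuousWithinAt)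
      (fun u hu => ((hz u (Ico_subset_Icc_self hu)).sub_const x₀).hasDerivWithinAt)
      (by simpa using ha)
      (fun u => by
        simpa using (((hasDerivAt_id u).sub_const a).const_mul M).const_add ρ)
      (fun u hu h => hb u (Ico_subset_Icc_self hu) ?_) (right_mem_Icc.2 hab)).trans hr
    rw [h]
    refine le_trans ?_ hr
    gcongr
    exact hu.2.le
  rcases le_total t₀ t with h | h
  · rw [uIcc_of_le h] at hy hM
    rw [abs_of_nonneg (sub_nonneg.2 h)] at hr
    exact key h hy hM h₀ hr
  · rw [uIcc_of_ge h] at hy hM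
    rw [abs_of_nonpos (sub_nonpos.2 h)] at hr
    have := key (z := fun u => y (-u)) (z' := fun u => -y' (-u)) (neg_le_neg h)
      (fun u hu => by
        have hu' : -u ∈ Icc t t₀ := ⟨by linarith [hu.2], by linarith [hu.1]⟩
        simpa [Function.comp_def] using (hy (-u) hu').scomp u (hasDerivAt_neg u))
      (fun u hu => by simpa using hM (-u) ⟨by linarith [hu.2], by linarith [hu.1]⟩)
      (by simpa using h₀) (by linarith)
    simpa using this

/-- Solutions depend jointly continuously on time and on a parameter as soon as they depend
continuously on the parameter at one time; only continuity of the vector field at the point is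
needed. -/
theorem continuousAt_uncurry_of_hasDerivAt {T : Type*} [TopologicalSpace T] {X : F → F}
    {G : ℝ → T → F} {τ₀ : ℝ} {t₀ : T} (hX : ContinuousAt X (G τ₀ t₀))
    (hG : ContinuousAt (G τ₀) t₀)
    (hode : ∀ᶠ p : ℝ × T in 𝓝 (τ₀, t₀), HasDerivAt (fun τ => G τ p.2) (X (G p.1 p.2)) p.1) :
    ContinuousAt (Function.uncurry G) (τ₀, t₀) := by
  set x₀ := G τ₀ t₀ with hx₀
  rw [Metric.continuousAt_iff']
  intro ε hε
  set M := ‖X x₀‖ + 1 with hMdef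
  have hM : 0 < M := by positivity
  obtain ⟨r₁, hr₁, hXr⟩ := Metric.eventually_nhds_iff_ball.1
    (hX.norm.eventually_lt (continuousAt_const (y := M)) (by simp [hMdef]))
  set r := min (r₁ / 2) (ε / 2)
  have hr : 0 < r := by positivity
  rw [nhds_prod_eq] at hode
  obtain ⟨p, hp, p', hp', hpp⟩ := eventually_prod_iff.1 hode
  obtain ⟨η, hη, hpη⟩ := Metric.eventually_nhds_iff_ball.1 hp
  have hball : Metric.ball τ₀ (min η (r / (2 * M))) ∈ 𝓝 τ₀ :=
    Metric.ball_mem_nhds _ (by positivity)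
  have hρ : ∀ᶠ t in 𝓝 t₀, ‖G τ₀ t - x₀‖ < r / 2 := by
    have := Metric.continuousAt_iff'.1 hG (r / 2) (by positivity)
    simpa [dist_eq_norm] using this
  rw [nhds_prod_eq]
  filter_upwards [prod_mem_prod hball (hp'.and hρ)]
  rintro ⟨τ, t⟩ ⟨hτ, ht, htρ⟩
  have hτ' : |τ - τ₀| < min η (r / (2 * M)) := by simpa [Real.dist_eq] using hτ
  have hu : ∀ u ∈ uIcc τ₀ τ, u ∈ Metric.ball τ₀ η := fun u hu => by
    rw [Metric.mem_ball, Real.dist_eq]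
    exact (abs_sub_left_of_mem_uIcc hu).trans_lt (hτ'.trans_le (min_le_left _ _))
  have hle : ‖G τ t - x₀‖ ≤ r := by
    refine norm_sub_le_of_norm_deriv_lt (y := fun u => G u t) (y' := fun u => X (G u t))
      (t₀ := τ₀) (ρ := r / 2) (M := M) (fun u h => hpp (hpη u (hu u h)) ht)
      (fun u _ h => hXr _ ?_) hM.le htρ.le ?_
    · rw [Metric.mem_ball, dist_eq_norm]
      exact h.trans_lt ((min_le_left _ _).trans_lt (by linarith))
    · have h1 : |τ - τ₀| ≤ r / (2 * M) := (hτ'.trans_le (min_le_right _ _)).le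
      have h2 : M * |τ - τ₀| ≤ M * (r / (2 * M)) := by gcongr
      have h3 : M * (r / (2 * M)) = r / 2 := by field_simp
      linarith
  change dist (G τ t) x₀ < ε
  rw [dist_eq_norm]
  exact hle.trans_lt ((min_le_right _ _).trans_lt (by linarith))

/-- The variational equation. If `τ ↦ G τ t` solves `x' = X x` for every parameter `t`, and `G τ` is
differentiable at `t₀` for every `τ`, then `w τ = ∂ₜ G τ t₀` solves the linearized equation.
The difference quotients `q` in `t` satisfy `q' = A q + o(1) q` by strict differentiability of
`X`, so that Grönwall's inequality and the mean value inequality bound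
`q τ - q τ₀ - (τ - τ₀) A q τ₀` uniformly in `t`. -/
theorem hasDerivAt_of_hasDerivAt_param {X : F → F} {A : F →L[ℝ] F} {G : ℝ → ℝ → F} {w : ℝ → F}
    {τ₀ t₀ : ℝ} (hX : HasStrictFDerivAt X A (G τ₀ t₀))
    (hode : ∀ᶠ p : ℝ × ℝ in 𝓝 (τ₀, t₀), HasDerivAt (fun τ => G τ p.2) (X (G p.1 p.2)) p.1)
    (hw : ∀ᶠ τ in 𝓝 τ₀, HasDerivAt (G τ) (w τ) t₀) :
    HasDerivAt w (A (w τ₀)) τ₀ := by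
  have hcont := continuousAt_uncurry_of_hasDerivAt hX.continuousAt hw.self_of_nhds.continuousAt hode
  rw [hasDerivAt_iff_isLittleO, Asymptotics.isLittleO_iff]
  intro c hc
  set W := ‖w τ₀‖ + 1
  set K := ‖A‖ + 1
  -- For `|τ - τ₀| ≤ 1 / K`, Grönwall's inequality bounds difference quotients by `C`.
  set C := Real.exp 1 * W
  have hW : 0 < W := by positivity
  have hK : 0 < K := by positivity
  have hC : 0 < C := by positivity
  -- The linearization error `c₁ C` and the error of replacing `q` by `q τ₀` each get `c / 2`.
  set c₁ := min 1 (c / (2 * C))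
  have hc₁ : 0 < c₁ := by positivity
  have hc₁C : c₁ * C ≤ c / 2 := by
    calc c₁ * C ≤ c / (2 * C) * C := by gcongr; exact min_le_right _ _
      _ = c / 2 := by field_simp
  have hstrict : ∀ᶠ p : F × F in 𝓝 (G τ₀ t₀, G τ₀ t₀),
      ‖X p.1 - X p.2 - A (p.1 - p.2)‖ ≤ c₁ * ‖p.1 - p.2‖ := hX.isLittleO.def hc₁
  have hpair : ContinuousAt (fun p : ℝ × ℝ => (G p.1 p.2, G p.1 t₀)) (τ₀, t₀) := by
    refine ContinuousAt.prodMk hcont ?_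
    exact ContinuousAt.comp (f := fun p : ℝ × ℝ => (p.1, t₀)) (x := (τ₀, t₀)) hcont
      (by fun_prop)
  have hode' : ∀ᶠ p : ℝ × ℝ in 𝓝 (τ₀, t₀), HasDerivAt (fun τ => G τ t₀) (X (G p.1 t₀)) p.1 := by
    have : ContinuousAt (fun p : ℝ × ℝ => (p.1, t₀)) (τ₀, t₀) := by fun_prop
    exact this.eventually hode
  have hall := (hpair.eventually hstrict).and (hode.and hode')
  rw [nhds_prod_eq] at hall
  obtain ⟨p, hp, p', hp', hpp⟩ := eventually_prod_iff.1 hall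
  obtain ⟨η, hη, hpη⟩ := Metric.eventually_nhds_iff_ball.1 hp
  have hball : Metric.ball τ₀ (min η (min (1 / K) (c / (2 * (‖A‖ + 1) * K * C)))) ∈ 𝓝 τ₀ :=
    Metric.ball_mem_nhds _ (by positivity)
  filter_upwards [hw, hball] with τ hwτ hτ
  have hτ' : |τ - τ₀| < min η (min (1 / K) (c / (2 * (‖A‖ + 1) * K * C))) := by
    simpa [Real.dist_eq] using hτ
  have hτη : |τ - τ₀| < η := hτ'.trans_le (min_le_left _ _)
  have hτK : K * |τ - τ₀| ≤ 1 := by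
    have h1 : |τ - τ₀| ≤ 1 / K := (hτ'.trans_le ((min_le_right _ _).trans (min_le_left _ _))).le
    calc K * |τ - τ₀| ≤ K * (1 / K) := by gcongr
      _ = 1 := by field_simp
  have hτc : ‖A‖ * (K * C * |τ - τ₀|) ≤ c / 2 := by
    have h1 : |τ - τ₀| ≤ c / (2 * (‖A‖ + 1) * K * C) :=
      (hτ'.trans_le ((min_le_right _ _).trans (min_le_right _ _))).le
    calc ‖A‖ * (K * C * |τ - τ₀|)
        ≤ (‖A‖ + 1) * (K * C * (c / (2 * (‖A‖ + 1) * K * C))) := by gcongr; linarith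
      _ = c / 2 := by field_simp
  have hslope : ∀ {u : ℝ}, HasDerivAt (G u) (w u) t₀ →
      Tendsto (fun t => (t - t₀)⁻¹ • (G u t - G u t₀)) (𝓝[≠] t₀) (𝓝 (w u)) := fun h => by
    simpa [slope_fun_def] using hasDerivAt_iff_tendsto_slope.1 h
  have h₀ := hslope hw.self_of_nhds
  have h₁ := hslope hwτ
  have hlim := ((h₁.sub h₀).sub ((A.continuous.tendsto _).comp h₀ |>.const_smul (τ - τ₀))).norm
  rw [Real.norm_eq_abs]
  refine le_of_tendsto hlim ?_
  have hWev : ∀ᶠ t in 𝓝[≠] t₀, ‖(t - t₀)⁻¹ • (G τ₀ t - G τ₀ t₀)‖ < W :=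
    h₀.norm.eventually_lt_const (by simp [W])
  filter_upwards [hWev, hp'.filter_mono nhdsWithin_le_nhds] with t htW ht
  have hin : ∀ u ∈ uIcc τ₀ τ, |u - τ₀| ≤ |τ - τ₀| := fun u hu => abs_sub_left_of_mem_uIcc hu
  have hfacts := fun u (hu : u ∈ uIcc τ₀ τ) => hpp (hpη u (by
    rw [Metric.mem_ball, Real.dist_eq]; exact (hin u hu).trans_lt hτη)) ht
  set q : ℝ → F := fun u => (t - t₀)⁻¹ • (G u t - G u t₀) with hq
  set q' : ℝ → F := fun u => (t - t₀)⁻¹ • (X (G u t) - X (G u t₀)) with hq'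
  have hqd : ∀ u ∈ uIcc τ₀ τ, HasDerivAt q (q' u) u := fun u hu =>
    ((hfacts u hu).2.1.sub (hfacts u hu).2.2).const_smul _
  have hqA : ∀ u ∈ uIcc τ₀ τ, ‖q' u - A (q u)‖ ≤ c₁ * ‖q u‖ := fun u hu => by
    have h := (hfacts u hu).1
    simp only [hq, hq', map_smul, ← smul_sub, norm_smul]
    calc _ ≤ ‖(t - t₀)⁻¹‖ * (c₁ * ‖G u t - G u t₀‖) := by gcongr
      _ = _ := by ring
  have hqK : ∀ u ∈ uIcc τ₀ τ, ‖q' u‖ ≤ K * ‖q u‖ := fun u hu => by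
    calc ‖q' u‖ = ‖A (q u) + (q' u - A (q u))‖ := by rw [add_sub_cancel]
      _ ≤ ‖A‖ * ‖q u‖ + 1 * ‖q u‖ := by
        refine (norm_add_le _ _).trans (add_le_add (A.le_opNorm _) ((hqA u hu).trans ?_))
        gcongr; exact min_le_left _ _
      _ = K * ‖q u‖ := by ring
  have hqC : ∀ u ∈ uIcc τ₀ τ, ‖q u‖ ≤ C := fun u hu => by
    have hsub : uIcc τ₀ u ⊆ uIcc τ₀ τ := uIcc_subset_uIcc_left hu
    refine (norm_le_exp_mul_of_norm_deriv_le (fun v hv => hqd v (hsub hv))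
      (fun v hv => hqK v (hsub hv))).trans ?_
    have : K * |u - τ₀| ≤ 1 :=
      (mul_le_mul_of_nonneg_left (hin u hu) hK.le).trans hτK
    exact mul_le_mul (Real.exp_le_exp.2 this) htW.le (norm_nonneg _) (Real.exp_pos _).le
  have hqsub : ∀ u ∈ uIcc τ₀ τ, ‖q u - q τ₀‖ ≤ K * C * |τ - τ₀| := fun u hu => by
    have := (convex_uIcc τ₀ τ).norm_image_sub_le_of_norm_hasDerivWithin_le (f := q) (f' := q')
      (C := K * C) (fun v hv => (hqd v hv).hasDerivWithinAt)
      (fun v hv => (hqK v hv).trans (by gcongr; exact hqC v hv)) left_mem_uIcc hu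
    exact this.trans (mul_le_mul_of_nonneg_left (hin u hu) (by positivity))
  have hfin := (convex_uIcc τ₀ τ).norm_image_sub_le_of_norm_hasDerivWithin_le
    (f := fun u => q u - u • A (q τ₀)) (f' := fun u => q' u - A (q τ₀)) (C := c)
    (fun v hv => by
      have := ((hqd v hv).sub ((hasDerivAt_id v).smul_const (A (q τ₀)))).hasDerivWithinAt
        (s := uIcc τ₀ τ)
      rwa [one_smul] at this)
    (fun v hv => by
      calc ‖q' v - A (q τ₀)‖ = ‖(q' v - A (q v)) + A (q v - q τ₀)‖ := by
            rw [map_sub]; abel_nf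
        _ ≤ c₁ * C + ‖A‖ * (K * C * |τ - τ₀|) := by
          refine (norm_add_le _ _).trans (add_le_add ((hqA v hv).trans ?_)
            ((A.le_opNorm _).trans ?_))
          · gcongr; exact hqC v hv
          · gcongr; exact hqsub v hv
        _ ≤ c := by linarith)
    left_mem_uIcc right_mem_uIcc
  rw [Real.norm_eq_abs] at hfin
  refine le_trans (le_of_eq ?_) hfin
  congr 1
  simp only [Function.comp_apply]
  rw [sub_smul]
  abel

end ODE

/-! ### Second derivatives and the variational equations of the flow -/

section Calculus

variable {F H : Type*} [NormedAddCommGroup F] [NormedSpace ℝ F]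
  [NormedAddCommGroup H] [NormedSpace ℝ H]

theorem two_le_infty : (2 : WithTop ℕ∞) ≤ ∞ := by
  exact ENat.LEInfty.out

theorem ContDiffAt.differentiableAt_fderiv {φ : F → H} {x : F} (hφ : ContDiffAt ℝ 2 φ x) :
    DifferentiableAt ℝ (fderiv ℝ φ) x :=
  (hφ.fderiv_right (m := 1) (by norm_num)).differentiableAt (by norm_num)

theorem fderiv_fderiv_apply {φ : F → H} {x : F} (hφ : DifferentiableAt ℝ (fderiv ℝ φ) x)
    (v w : F) : fderiv ℝ (fun y => fderiv ℝ φ y v) x w = fderiv ℝ (fderiv ℝ φ) x w v := by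
  rw [(hφ.hasFDerivAt.clm_apply (hasFDerivAt_const v x)).fderiv]
  simp

/-- The second derivative of a composition along a fixed direction (Faà di Bruno's formula of
order two). -/
theorem fderiv_fderiv_comp_apply {G : Type*} [NormedAddCommGroup G] [NormedSpace ℝ G]
    {f : H → G} {φ : F → H} {x : F} (hf : ContDiffAt ℝ 2 f (φ x)) (hφ : ContDiffAt ℝ 2 φ x)
    (v : F) :
    fderiv ℝ (fderiv ℝ (f ∘ φ)) x v v =
      fderiv ℝ (fderiv ℝ f) (φ x) (fderiv ℝ φ x v) (fderiv ℝ φ x v) +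
        fderiv ℝ f (φ x) (fderiv ℝ (fderiv ℝ φ) x v v) := by
  have hev : fderiv ℝ (f ∘ φ) =ᶠ[𝓝 x] fun y => (fderiv ℝ f (φ y)).comp (fderiv ℝ φ y) := by
    filter_upwards [hφ.continuousAt.eventually (hf.eventually (by simp)), hφ.eventually (by simp)]
      with y hfy hφy
    exact fderiv_comp y (hfy.differentiableAt (by norm_num)) (hφy.differentiableAt (by norm_num))
  have hd := ((hf.differentiableAt_fderiv.hasFDerivAt).comp x
    (hφ.differentiableAt (by norm_num)).hasFDerivAt).clm_comp
      hφ.differentiableAt_fderiv.hasFDerivAt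
  rw [hev.fderiv_eq, HasFDerivAt.fderiv (f := fun y => (fderiv ℝ f (φ y)).comp (fderiv ℝ φ y)) hd]
  simp [add_comm]

theorem hasDerivAt_comp_add_smul {φ : F → H} {x v : F} {t : ℝ}
    (hφ : DifferentiableAt ℝ φ (x + t • v)) :
    HasDerivAt (fun t : ℝ => φ (x + t • v)) (fderiv ℝ φ (x + t • v) v) t := by
  have h : HasDerivAt (fun t : ℝ => x + t • v) v t := by
    simpa using ((hasDerivAt_id t).smul_const v).const_add x
  exact hφ.hasFDerivAt.comp_hasDerivAt t h

/-- The chain rule along a product curve, in terms of the two partial derivatives. -/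
theorem hasDerivAt_uncurry_comp {F' : Type*} [NormedAddCommGroup F'] [NormedSpace ℝ F']
    {φ : F → F' → H} {x x' : ℝ → F} {y y' : ℝ → F'} {t : ℝ}
    (hφ : DifferentiableAt ℝ (fun p : F × F' => φ p.1 p.2) (x t, y t))
    (hx : HasDerivAt x (x' t) t) (hy : HasDerivAt y (y' t) t) :
    HasDerivAt (fun u => φ (x u) (y u))
      (fderiv ℝ (fun z => φ z (y t)) (x t) (x' t) + fderiv ℝ (fun z => φ (x t) z) (y t) (y' t))
      t := by
  have h := hφ.hasFDerivAt.comp_hasDerivAt t (hx.prodMk hy)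
  have h1 := hφ.hasFDerivAt.comp (x t) (hasFDerivAt_prodMk_left (𝕜 := ℝ) (x t) (y t))
  have h2 := hφ.hasFDerivAt.comp (y t) (hasFDerivAt_prodMk_right (𝕜 := ℝ) (x t) (y t))
  rw [show (fun z => φ z (y t)) = (fun p : F × F' => φ p.1 p.2) ∘ (fun z => (z, y t)) from rfl,
    show (fun z => φ (x t) z) = (fun p : F × F' => φ p.1 p.2) ∘ (fun z => (x t, z)) from rfl,
    h1.fderiv, h2.fderiv]
  refine HasDerivAt.congr_deriv (f := fun u => φ (x u) (y u)) h ?_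
  simp [← map_add]

end Calculus

namespace VPS

section Trace

variable {n q : ℕ}

/-- If `M = ∑ₖ vₖ vₖᵀ`, then `tr (M ∇²f) = ∑ₖ D²f (vₖ, vₖ)`. -/
theorem trace_mul_hess {M : Matrix (Fin n) (Fin n) ℝ} {v : Fin q → E n}
    (hM : ∀ i j, M i j = ∑ k, v k i * v k j) {f : E n → ℝ} {x : E n}
    (hf : DifferentiableAt ℝ (fderiv ℝ f) x) :
    (M * hess f x).trace = ∑ k, fderiv ℝ (fderiv ℝ f) x (v k) (v k) := by
  have hv : ∀ w : E n, w = ∑ i, w i • EuclideanSpace.single i (1 : ℝ) := fun w => by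
    simpa using ((EuclideanSpace.basisFun (Fin n) ℝ).sum_repr w).symm
  have hexp : ∀ k, fderiv ℝ (fderiv ℝ f) x (v k) (v k) =
      ∑ i, ∑ j, v k i * v k j * fderiv ℝ (fderiv ℝ f) x (EuclideanSpace.single j 1)
        (EuclideanSpace.single i 1) := fun k => by
    conv_lhs => rw [hv (v k)]
    simp only [map_sum, map_smul, sum_apply, smul_apply,
      smul_eq_mul, Finset.mul_sum]
    refine Finset.sum_congr rfl fun i _ => Finset.sum_congr rfl fun j _ => by ring
  simp only [Matrix.trace, Matrix.diag, Matrix.mul_apply, hess, Matrix.of_apply, hM,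
    fderiv_fderiv_apply hf, hexp, Finset.sum_mul]
  conv_rhs => rw [Finset.sum_comm]
  exact Finset.sum_congr rfl fun i _ => Finset.sum_comm

theorem secondOrder_eq_sum {M : Matrix (Fin n) (Fin n) ℝ} {v : Fin q → E n}
    (hM : ∀ i j, M i j = ∑ k, v k i * v k j) {X : E n → E n} {x : E n}
    (hX : ContDiffAt ℝ 2 X x) :
    secondOrder M X x = ∑ k, fderiv ℝ (fderiv ℝ X) x (v k) (v k) := by
  ext l
  set π : E n →L[ℝ] ℝ := EuclideanSpace.proj l
  have hl : (fun y => X y l) = π ∘ X := rfl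
  have hXl : ContDiffAt ℝ 2 (fun y => X y l) x := π.contDiff.contDiffAt.comp x hX
  have hπ : fderiv ℝ π = fun _ => π := by
    ext1 y; exact π.fderiv
  simp only [secondOrder, trace_mul_hess hM hXl.differentiableAt_fderiv]
  rw [WithLp.ofLp_sum, Finset.sum_apply]
  refine Finset.sum_congr rfl fun k _ => ?_
  rw [hl, fderiv_fderiv_comp_apply π.contDiff.contDiffAt hX, hπ]
  simp [π]

end Trace

section Flow

variable {n : ℕ} {X : E n → E n} {S U : Set (E n)} {ε₀ : ℝ} {g : ℝ → E n → E n}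

theorem IsDiffeoFlow.contDiffAt (hg : IsDiffeoFlow X S U ε₀ g) (hU : IsOpen U) {τ : ℝ}
    (hτ : |τ| < ε₀) {s : E n} (hs : s ∈ U) : ContDiffAt ℝ ∞ (g τ) s :=
  (hg.diffeo τ hτ).2.1.contDiffAt (hU.mem_nhds hs)

theorem eventually_abs_lt {τ ε₀ : ℝ} (hτ : |τ| < ε₀) : ∀ᶠ u in 𝓝 τ, |u| < ε₀ :=
  continuous_abs.continuousAt.eventually_lt_const hτ

theorem eventually_add_smul_mem (hU : IsOpen U) {s v : E n} {t : ℝ} (hs : s + t • v ∈ U) :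
    ∀ᶠ u : ℝ in 𝓝 t, s + u • v ∈ U :=
  ContinuousAt.eventually_mem (f := fun u : ℝ => s + u • v) (by fun_prop) (hU.mem_nhds hs)

/-- The first variational equation, for the derivative of the flow maps in direction `v`. -/
theorem IsDiffeoFlow.hasDerivAt_fderiv (hg : IsDiffeoFlow X S U ε₀ g) (hS : IsOpen S)
    (hU : IsOpen U) (hX : ContDiffOn ℝ ∞ X S) {τ : ℝ} (hτ : |τ| < ε₀) {s : E n} (hs : s ∈ U)
    (v : E n) :
    HasDerivAt (fun τ => fderiv ℝ (g τ) s v) (fderiv ℝ X (g τ s) (fderiv ℝ (g τ) s v)) τ := by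
  have hs0 : s + (0 : ℝ) • v ∈ U := by simpa using hs
  have hXs : HasStrictFDerivAt X (fderiv ℝ X (g τ s)) (g τ s) :=
    (hX.contDiffAt (hS.mem_nhds (hg.mem τ hτ s hs))).hasStrictFDerivAt (by simp)
  refine hasDerivAt_of_hasDerivAt_param (G := fun τ t => g τ (s + t • v)) (t₀ := 0)
    (by simpa using hXs) ?_ ?_
  · rw [nhds_prod_eq]
    filter_upwards [prod_mem_prod (eventually_abs_lt hτ) (eventually_add_smul_mem hU hs0)]
    rintro ⟨u, t⟩ ⟨hu, ht⟩
    exact hg.ode u hu _ ht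
  · filter_upwards [eventually_abs_lt hτ] with u hu
    simpa using hasDerivAt_comp_add_smul
      ((hg.contDiffAt hU hu hs0).differentiableAt (by simp))

/-- The second variational equation: the first one, applied to the flow
`(x, w) ↦ (g x, Dg(x) w)` that `X` induces on the tangent bundle. -/
theorem IsDiffeoFlow.hasDerivAt_fderiv_fderiv (hg : IsDiffeoFlow X S U ε₀ g) (hS : IsOpen S)
    (hU : IsOpen U) (hX : ContDiffOn ℝ ∞ X S) {τ : ℝ} (hτ : |τ| < ε₀) {s : E n} (hs : s ∈ U)
    (v : E n) :
    HasDerivAt (fun τ => fderiv ℝ (fderiv ℝ (g τ)) s v v)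
      (fderiv ℝ (fderiv ℝ X) (g τ s) (fderiv ℝ (g τ) s v) (fderiv ℝ (g τ) s v) +
        fderiv ℝ X (g τ s) (fderiv ℝ (fderiv ℝ (g τ)) s v v)) τ := by
  have hs0 : s + (0 : ℝ) • v ∈ U := by simpa using hs
  have hXc : ContDiffAt ℝ ∞ X (g τ s) := hX.contDiffAt (hS.mem_nhds (hg.mem τ hτ s hs))
  have hX1 : HasStrictFDerivAt X (fderiv ℝ X (g τ s)) (g τ s) := hXc.hasStrictFDerivAt (by simp)
  have hX2 : HasStrictFDerivAt (fderiv ℝ X) (fderiv ℝ (fderiv ℝ X) (g τ s)) (g τ s) :=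
    ((hXc.of_le two_le_infty).fderiv_right (m := 1) (by norm_num)).hasStrictFDerivAt (by simp)
  set w := fderiv ℝ (g τ) s v with hw
  have hfst : HasStrictFDerivAt (Prod.fst : E n × E n → E n) (.fst ℝ (E n) (E n)) (g τ s, w) :=
    hasStrictFDerivAt_fst
  have hXhat := (hX1.comp (g τ s, w) hfst).prodMk
    ((hX2.comp (g τ s, w) hfst).clm_apply (hasStrictFDerivAt_snd (𝕜 := ℝ) (p := (g τ s, w))))
  have key := hasDerivAt_of_hasDerivAt_param
    (G := fun τ t => (g τ (s + t • v), fderiv ℝ (g τ) (s + t • v) v)) (t₀ := 0) (τ₀ := τ)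
    (w := fun τ => (fderiv ℝ (g τ) s v, fderiv ℝ (fderiv ℝ (g τ)) s v v))
    (by simpa using hXhat) ?_ ?_
  · have h2 := (ContinuousLinearMap.snd ℝ (E n) (E n)).hasFDerivAt.comp_hasDerivAt τ key
    simpa [Function.comp_def, add_comm] using h2
  · rw [nhds_prod_eq]
    filter_upwards [prod_mem_prod (eventually_abs_lt hτ) (eventually_add_smul_mem hU hs0)]
    rintro ⟨u, t⟩ ⟨hu, ht⟩
    exact (hg.ode u hu _ ht).prodMk (hg.hasDerivAt_fderiv hS hU hX hu ht v)
  · filter_upwards [eventually_abs_lt hτ] with u hu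
    have hc := hg.contDiffAt hU hu hs0
    have h1 := hasDerivAt_comp_add_smul (hc.differentiableAt (by simp))
    have h2 := hasDerivAt_comp_add_smul
      ((hc.of_le two_le_infty : ContDiffAt ℝ 2 _ _).differentiableAt_fderiv)
    have h3 := h1.prodMk (h2.clm_apply (hasDerivAt_const 0 v))
    simpa using h3

end Flow

end VPS

/-! ### Transport of the coefficients along orbits -/

/-- Uniqueness of the zero solution of a linear equation, with a locally bounded rate `κ`. -/
theorem eq_zero_of_norm_deriv_le_mul {F : Type*} [NormedAddCommGroup F] [NormedSpace ℝ F]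
    {y y' : ℝ → F} {κ : ℝ → ℝ} {t₀ t : ℝ} (hκ : ContinuousOn κ (uIcc t₀ t))
    (hy : ∀ u ∈ uIcc t₀ t, HasDerivAt y (y' u) u)
    (hle : ∀ u ∈ uIcc t₀ t, ‖y' u‖ ≤ κ u * ‖y u‖) (h₀ : y t₀ = 0) : y t = 0 := by
  obtain ⟨K, hK⟩ := (isCompact_uIcc.image_of_continuousOn hκ).bddAbove
  have := norm_le_exp_mul_of_norm_deriv_le hy (K := K) fun u hu =>
    (hle u hu).trans (by gcongr; exact hK (mem_image_of_mem κ hu))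
  simpa [h₀] using this

namespace VPS

theorem inner_gradient_eq_fderiv {n : ℕ} (f : E n → ℝ) (x v : E n) :
    inner ℝ v (gradient f x) = fderiv ℝ f x v := by
  rw [real_inner_comm, gradient, InnerProductSpace.toDual_symm_apply]

theorem abs_jac_le {n : ℕ} (X : E n → E n) (x : E n) (i j : Fin n) :
    |jac X x i j| ≤ ‖fderiv ℝ X x‖ := by
  have h := (PiLp.norm_apply_le (fderiv ℝ X x (EuclideanSpace.single j 1)) i).trans
    ((fderiv ℝ X x).le_opNorm _)
  simpa [jac] using h

theorem fderiv_apply_eq_sum_jac {n : ℕ} (X : E n → E n) (x v : E n) (i : Fin n) :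
    fderiv ℝ X x v i = ∑ l, jac X x i l * v l := by
  have hv : v = ∑ l, v l • EuclideanSpace.single l (1 : ℝ) := by
    simpa using ((EuclideanSpace.basisFun (Fin n) ℝ).sum_repr v).symm
  conv_lhs => rw [hv]
  simp [jac, mul_comm]

namespace ControlledDiffusion

variable {d m q : ℕ} (D : ControlledDiffusion d m q)

/-- The `k`-th column of the diffusion coefficient: the direction driven by the `k`-th component
of the Brownian motion. -/
def noiseDir (s : E d) (a : E m) (k : Fin q) : E d :=
  WithLp.toLp 2 fun i => D.σ s a i k

theorem Q_apply (s : E d) (a : E m) (i j : Fin d) :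
    D.Q s a i j = ∑ k, D.noiseDir s a k i * D.noiseDir s a k j := by
  simp [Q, Matrix.mul_apply, noiseDir]

/-- The generator as a differential operator along the noise directions. The diffusion matrix may
be factored into any vectors `v k`, not only into the noise directions. -/
theorem generator_eq {s : E d} {a : E m} {v : Fin q → E d}
    (hv : ∀ i j, D.Q s a i j = ∑ k, v k i * v k j) {f : E d → ℝ} (hf : ContDiffAt ℝ 2 f s) :
    D.generator a f s = fderiv ℝ f s (D.b s a) +
      (1 / 2) * ∑ k, fderiv ℝ (fderiv ℝ f) s (v k) (v k) := by
  rw [generator, trace_mul_hess hv hf.differentiableAt_fderiv, inner_gradient_eq_fderiv]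

variable {D} {X : E d → E d} {Y : E m → E m} {S U : Set (E d)} {A V : Set (E m)} {ε₀ ε : ℝ}
  {g : ℝ → E d → E d} {h : ℝ → E m → E m} {s : E d} {a : E m}

theorem reward_flow (hS : IsOpen S) (hA : IsOpen A) (hD : D.SmoothOn S A)
    (hg : IsDiffeoFlow X S U ε₀ g) (hh : IsDiffeoFlow Y A V ε₀ h) (hs : s ∈ U) (ha : a ∈ V)
    (hε : ∀ τ ∈ uIcc 0 ε, |τ| < ε₀)
    (hdet : ∀ τ ∈ uIcc 0 ε, D.RewardEq X Y (g τ s) (h τ a)) :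
    D.r (g ε s) (h ε a) = D.r s a := by
  have h0 := hε 0 left_mem_uIcc
  have key := eq_zero_of_norm_deriv_le_mul (κ := fun _ => 0) (t₀ := 0) (t := ε)
    (y := fun τ => D.r (g τ s) (h τ a) - D.r s a) (y' := fun _ => 0) continuousOn_const
    (fun τ hτ => by
      have hmem := (hS.prod hA).mem_nhds
        (mk_mem_prod (hg.mem τ (hε τ hτ) s hs) (hh.mem τ (hε τ hτ) a ha))
      have hd := (hasDerivAt_uncurry_comp ((hD.2.2.contDiffAt hmem).differentiableAt (by simp))
        (x := fun τ => g τ s) (x' := fun τ => X (g τ s)) (y' := fun τ => Y (h τ a))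
        (hg.ode τ (hε τ hτ) s hs) (hh.ode τ (hε τ hτ) a ha)).sub_const (D.r s a)
      have hr := hdet τ hτ
      simp only [RewardEq, inner_gradient_eq_fderiv] at hr
      rwa [hr] at hd)
    (by simp) (by simp [hg.zero s hs, hh.zero a ha])
  exact sub_eq_zero.1 key

theorem continuousOn_norm_fderiv_flow (hS : IsOpen S) (hX : ContDiffOn ℝ ∞ X S)
    (hg : IsDiffeoFlow X S U ε₀ g) (hs : s ∈ U) (hε : ∀ τ ∈ uIcc 0 ε, |τ| < ε₀) :
    ContinuousOn (fun τ => ‖fderiv ℝ X (g τ s)‖) (uIcc 0 ε) := fun τ hτ => by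
  have hc := (((hX.contDiffAt (hS.mem_nhds (hg.mem τ (hε τ hτ) s hs))).of_le
    two_le_infty).differentiableAt_fderiv).continuousAt
  exact (ContinuousAt.comp (f := fun τ => g τ s) (x := τ) hc
    (hg.ode τ (hε τ hτ) s hs).continuousAt).norm.continuousWithinAt

theorem fderiv_flow_zero (hU : IsOpen U) (hg : IsDiffeoFlow X S U ε₀ g) (hs : s ∈ U) :
    fderiv ℝ (g 0) s = .id ℝ (E d) := by
  have : g 0 =ᶠ[𝓝 s] id := by
    filter_upwards [hU.mem_nhds hs] with y hy using hg.zero y hy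
  rw [this.fderiv_eq, fderiv_id]

theorem fderiv_fderiv_flow_zero (hU : IsOpen U) (hg : IsDiffeoFlow X S U ε₀ g) (hs : s ∈ U) :
    fderiv ℝ (fderiv ℝ (g 0)) s = 0 := by
  have : fderiv ℝ (g 0) =ᶠ[𝓝 s] fun _ => .id ℝ (E d) := by
    filter_upwards [hU.mem_nhds hs] with y hy using fderiv_flow_zero hU hg hy
  rw [this.fderiv_eq]; simp

/-- The diffusion matrix is transported by the flow, `Q(g s, h a) = Dg(s) Q(s, a) Dg(s)ᵀ`. The
difference `R` of the two sides satisfies `R' = (∇X) R + R (∇X)ᵀ` along the orbit. -/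
theorem Q_flow (hS : IsOpen S) (hA : IsOpen A) (hU : IsOpen U) (hD : D.SmoothOn S A)
    (hX : ContDiffOn ℝ ∞ X S)
    (hg : IsDiffeoFlow X S U ε₀ g) (hh : IsDiffeoFlow Y A V ε₀ h) (hs : s ∈ U) (ha : a ∈ V)
    (hε : ∀ τ ∈ uIcc 0 ε, |τ| < ε₀)
    (hdet : ∀ τ ∈ uIcc 0 ε, D.DiffusionEq X Y (g τ s) (h τ a)) (i j : Fin d) :
    D.Q (g ε s) (h ε a) i j =
      ∑ k, fderiv ℝ (g ε) s (D.noiseDir s a k) i * fderiv ℝ (g ε) s (D.noiseDir s a k) j := by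
  set w : ℝ → Fin q → E d := fun τ k => fderiv ℝ (g τ) s (D.noiseDir s a k) with hw
  set R : ℝ → Fin d → Fin d → ℝ := fun τ i j =>
    D.Q (g τ s) (h τ a) i j - ∑ k, w τ k i * w τ k j with hR
  set J : ℝ → Matrix (Fin d) (Fin d) ℝ := fun τ => jac X (g τ s)
  have hRd : ∀ τ ∈ uIcc 0 ε, HasDerivAt R
      (fun i j => ∑ l, J τ i l * R τ l j + ∑ l, R τ i l * J τ j l) τ := by
    intro τ hτ
    refine hasDerivAt_pi.2 fun i => hasDerivAt_pi.2 fun j => ?_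
    have hmem := (hS.prod hA).mem_nhds
      (mk_mem_prod (hg.mem τ (hε τ hτ) s hs) (hh.mem τ (hε τ hτ) a ha))
    have hQ := hasDerivAt_uncurry_comp (φ := fun s a => D.Q s a i j)
      (((hD.2.1 i j).contDiffAt hmem).differentiableAt (by simp))
      (x := fun τ => g τ s) (x' := fun τ => X (g τ s)) (y' := fun τ => Y (h τ a))
      (hg.ode τ (hε τ hτ) s hs) (hh.ode τ (hε τ hτ) a ha)
    have hwi : ∀ k i, HasDerivAt (fun τ => w τ k i) (∑ l, J τ i l * w τ k l) τ := fun k i => by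
      have h1 := hg.hasDerivAt_fderiv hS hU hX (hε τ hτ) hs (D.noiseDir s a k)
      let π : E d →L[ℝ] ℝ := EuclideanSpace.proj i
      rw [← fderiv_apply_eq_sum_jac]
      exact π.hasFDerivAt.comp_hasDerivAt τ h1
    have hsum := HasDerivAt.fun_sum (u := Finset.univ) fun k _ => (hwi k i).mul (hwi k j)
    refine (hQ.sub hsum).congr_deriv ?_
    have hdiff := congrFun (congrFun (hdet τ hτ) i) j
    simp only [Matrix.add_apply, Matrix.sub_apply, Matrix.of_apply, Matrix.mul_apply,
      Matrix.transpose_apply, Matrix.zero_apply] at hdiff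
    -- The diffusion equation replaces the derivative of `Q` by `J Q + Q Jᵀ`, so that
    -- `R' = J R + R Jᵀ`.
    have hsplit1 : ∑ l, J τ i l * R τ l j = ∑ l, J τ i l * D.Q (g τ s) (h τ a) l j -
        ∑ k, (∑ l, J τ i l * w τ k l) * w τ k j := by
      simp only [hR, mul_sub, Finset.sum_sub_distrib, Finset.mul_sum, Finset.sum_mul]
      rw [Finset.sum_comm (γ := Fin q)]
      simp only [mul_assoc]
    have hsplit2 : ∑ l, R τ i l * J τ j l = ∑ l, D.Q (g τ s) (h τ a) i l * J τ j l -
        ∑ k, w τ k i * (∑ l, J τ j l * w τ k l) := by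
      simp only [hR, sub_mul, Finset.sum_sub_distrib, Finset.mul_sum, Finset.sum_mul]
      rw [Finset.sum_comm (γ := Fin q)]
      congr 1
      refine Finset.sum_congr rfl fun k _ => Finset.sum_congr rfl fun l _ => by ring
    rw [hsplit1, hsplit2, Finset.sum_add_distrib]
    linarith
  have hzero : R ε = 0 := by
    refine eq_zero_of_norm_deriv_le_mul (κ := fun τ => 2 * d * ‖fderiv ℝ X (g τ s)‖) (t₀ := 0)
      ((continuousOn_norm_fderiv_flow hS hX hg hs hε).const_mul _) hRd (fun τ hτ => ?_) ?_
    · have hRle : ∀ i j, |R τ i j| ≤ ‖R τ‖ := fun i j =>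
        (norm_le_pi_norm (R τ i) j).trans (norm_le_pi_norm (R τ) i)
      have hJle : ∀ i j, |J τ i j| ≤ ‖fderiv ℝ X (g τ s)‖ := abs_jac_le X (g τ s)
      refine (pi_norm_le_iff_of_nonneg (by positivity)).2 fun i =>
        (pi_norm_le_iff_of_nonneg (by positivity)).2 fun j => ?_
      have h1 : |∑ l, J τ i l * R τ l j| ≤ ∑ _l : Fin d, ‖fderiv ℝ X (g τ s)‖ * ‖R τ‖ :=
        (Finset.abs_sum_le_sum_abs _ _).trans (Finset.sum_le_sum fun l _ => by
          rw [abs_mul]; gcongr; exacts [hJle i l, hRle l j])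
      have h2 : |∑ l, R τ i l * J τ j l| ≤ ∑ _l : Fin d, ‖fderiv ℝ X (g τ s)‖ * ‖R τ‖ :=
        (Finset.abs_sum_le_sum_abs _ _).trans (Finset.sum_le_sum fun l _ => by
          rw [abs_mul, mul_comm]; gcongr; exacts [hJle j l, hRle i l])
      rw [Finset.sum_const, Finset.card_univ, Fintype.card_fin, nsmul_eq_mul] at h1 h2
      rw [Real.norm_eq_abs]
      exact (abs_add_le _ _).trans (by linarith)
    · ext i j
      simp [hR, hw, hg.zero s hs, hh.zero a ha, fderiv_flow_zero hU hg hs, D.Q_apply]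
  exact sub_eq_zero.1 (congrFun (congrFun hzero i) j)

/-- The drift is transported by the flow with an Itô correction,
`b(g s, h a) = Dg(s) b(s, a) + ½ Δ_Q g(s)`. The difference `P` of the two sides satisfies
`P' = (∇X) P` along the orbit. -/
theorem b_flow (hS : IsOpen S) (hA : IsOpen A) (hU : IsOpen U) (hD : D.SmoothOn S A)
    (hX : ContDiffOn ℝ ∞ X S)
    (hg : IsDiffeoFlow X S U ε₀ g) (hh : IsDiffeoFlow Y A V ε₀ h) (hs : s ∈ U) (ha : a ∈ V)
    (hε : ∀ τ ∈ uIcc 0 ε, |τ| < ε₀)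
    (hdiff : ∀ τ ∈ uIcc 0 ε, D.DiffusionEq X Y (g τ s) (h τ a))
    (hdrift : ∀ τ ∈ uIcc 0 ε, D.DriftEq X Y (g τ s) (h τ a)) :
    D.b (g ε s) (h ε a) = fderiv ℝ (g ε) s (D.b s a) +
      (1 / 2 : ℝ) • ∑ k, fderiv ℝ (fderiv ℝ (g ε)) s (D.noiseDir s a k) (D.noiseDir s a k) := by
  set v := D.noiseDir s a with hv
  set P : ℝ → E d := fun τ => D.b (g τ s) (h τ a) - (fderiv ℝ (g τ) s (D.b s a) +
      (1 / 2 : ℝ) • ∑ k, fderiv ℝ (fderiv ℝ (g τ)) s (v k) (v k)) with hP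
  have hPd : ∀ τ ∈ uIcc 0 ε, HasDerivAt P (fderiv ℝ X (g τ s) (P τ)) τ := by
    intro τ hτ
    have hτ₀ := hε τ hτ
    have hmem := (hS.prod hA).mem_nhds (mk_mem_prod (hg.mem τ hτ₀ s hs) (hh.mem τ hτ₀ a ha))
    have hb := hasDerivAt_uncurry_comp (φ := D.b)
      ((hD.1.contDiffAt hmem).differentiableAt (by simp))
      (x := fun τ => g τ s) (x' := fun τ => X (g τ s)) (y' := fun τ => Y (h τ a))
      (hg.ode τ hτ₀ s hs) (hh.ode τ hτ₀ a ha)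
    have hsum := HasDerivAt.fun_sum (u := Finset.univ) fun k _ =>
      hg.hasDerivAt_fderiv_fderiv hS hU hX hτ₀ hs (v k)
    refine (hb.sub ((hg.hasDerivAt_fderiv hS hU hX hτ₀ hs (D.b s a)).add
      (hsum.const_smul (1 / 2 : ℝ)))).congr_deriv ?_
    have hsub : uIcc 0 τ ⊆ uIcc 0 ε := uIcc_subset_uIcc_left hτ
    -- `Q` at the orbit point factors through the transported noise directions, which turns the term
    -- `Δ_Q X` of the drift equation into the inhomogeneity of the second variational equation.
    have hQ := Q_flow hS hA hU hD hX hg hh hs ha (fun u hu => hε u (hsub hu))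
      (fun u hu => hdiff u (hsub hu))
    have hXc : ContDiffAt ℝ 2 X (g τ s) :=
      (hX.contDiffAt (hS.mem_nhds (hg.mem τ hτ₀ s hs))).of_le two_le_infty
    have hdr := hdrift τ hτ
    rw [DriftEq, secondOrder_eq_sum hQ hXc] at hdr
    simp only [hP, map_sub, map_add, map_smul, map_sum, Finset.sum_add_distrib, smul_add]
    rw [← sub_eq_zero, ← hdr]
    abel
  have hzero : P ε = 0 :=
    eq_zero_of_norm_deriv_le_mul (continuousOn_norm_fderiv_flow hS hX hg hs hε) hPd
      (fun τ _ => ContinuousLinearMap.le_opNorm _ _)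
      (by simp [hP, hg.zero s hs, hh.zero a ha, fderiv_flow_zero hU hg hs,
        fderiv_fderiv_flow_zero hU hg hs])
  exact sub_eq_zero.1 hzero

/-- The generator is intertwined by the flow: after the second-order chain rule, its first- and
second-order parts match by `b_flow` and `Q_flow`. -/
theorem generator_flow (hS : IsOpen S) (hA : IsOpen A) (hU : IsOpen U) (hD : D.SmoothOn S A)
    (hX : ContDiffOn ℝ ∞ X S)
    (hg : IsDiffeoFlow X S U ε₀ g) (hh : IsDiffeoFlow Y A V ε₀ h) (hs : s ∈ U) (ha : a ∈ V)
    (hε : ∀ τ ∈ uIcc 0 ε, |τ| < ε₀)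
    (hdiff : ∀ τ ∈ uIcc 0 ε, D.DiffusionEq X Y (g τ s) (h τ a))
    (hdrift : ∀ τ ∈ uIcc 0 ε, D.DriftEq X Y (g τ s) (h τ a))
    {f : E d → ℝ} (hf : ContDiffOn ℝ 2 f S) :
    D.generator a (f ∘ g ε) s = D.generator (h ε a) f (g ε s) := by
  have hε' := hε ε right_mem_uIcc
  have hfc : ContDiffAt ℝ 2 f (g ε s) := hf.contDiffAt (hS.mem_nhds (hg.mem ε hε' s hs))
  have hgc : ContDiffAt ℝ 2 (g ε) s := (hg.contDiffAt hU hε' hs).of_le two_le_infty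
  rw [D.generator_eq (D.Q_apply s a) (hfc.comp s hgc),
    D.generator_eq (Q_flow hS hA hU hD hX hg hh hs ha hε hdiff) hfc,
    b_flow hS hA hU hD hX hg hh hs ha hε hdiff hdrift,
    fderiv_comp s (hfc.differentiableAt (by norm_num)) (hgc.differentiableAt (by norm_num))]
  simp only [fderiv_fderiv_comp_apply hfc hgc, ContinuousLinearMap.comp_apply, map_add, map_smul,
    map_sum, Finset.sum_add_distrib, smul_eq_mul]
  ring

theorem exactValuePreservingOn_staysIn {Ω : Set (E d × E m)} (hS : IsOpen S) (hA : IsOpen A)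
    (hU : IsOpen U) (hΩUV : Ω ⊆ U ×ˢ V) (hD : D.SmoothOn S A) (hX : ContDiffOn ℝ ∞ X S)
    (hdet : D.DeterminingEqsOn X Y Ω)
    (hg : IsDiffeoFlow X S U ε₀ g) (hh : IsDiffeoFlow Y A V ε₀ h) (hε : |ε| < ε₀) :
    D.ExactValuePreservingOn S (staysIn Ω g h ε) (g ε) (h ε) := by
  have hτ : ∀ τ ∈ uIcc 0 ε, |τ| < ε₀ := fun τ hτ => by
    simpa using (abs_sub_left_of_mem_uIcc hτ).trans_lt (by simpa using hε)
  exact ⟨fun f hf p hp => generator_flow hS hA hU hD hX hg hh (hΩUV hp.1).1 (hΩUV hp.1).2 hτ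
      (fun τ h => (hdet _ (hp.2 τ h)).2.2) (fun τ h => (hdet _ (hp.2 τ h)).2.1) hf,
    fun p hp => reward_flow hS hA hD hg hh (hΩUV hp.1).1 (hΩUV hp.1).2 hτ
      (fun τ h => (hdet _ (hp.2 τ h)).1)⟩

end ControlledDiffusion

/-! ### Compact sets of initial points -/

theorem IsDiffeoFlow.continuousAt_zero {n : ℕ} {X : E n → E n} {S U : Set (E n)} {ε₀ : ℝ}
    {g : ℝ → E n → E n} (hg : IsDiffeoFlow X S U ε₀ g) (hε₀ : 0 < ε₀) (hS : IsOpen S)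
    (hU : IsOpen U) (hX : ContinuousOn X S) {s : E n} (hs : s ∈ U) :
    ContinuousAt (Function.uncurry g) (0, s) := by
  have h0 : |(0 : ℝ)| < ε₀ := by simpa using hε₀
  refine continuousAt_uncurry_of_hasDerivAt
    (hX.continuousAt (hS.mem_nhds (hg.mem 0 h0 s hs))) (hg.contDiffAt hU h0 hs).continuousAt ?_
  rw [nhds_prod_eq]
  filter_upwards [prod_mem_prod (eventually_abs_lt h0) (hU.mem_nhds hs)]
  rintro ⟨u, t⟩ ⟨hu, ht⟩
  exact hg.ode u hu _ ht

/-- Points of a compact subset of `Ω` stay in `Ω` for a uniform time. -/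
theorem exists_forall_mem_staysIn {d m : ℕ} {X : E d → E d} {Y : E m → E m} {S U : Set (E d)}
    {A V : Set (E m)} {ε₀ : ℝ} {g : ℝ → E d → E d} {h : ℝ → E m → E m} {Ω K : Set (E d × E m)}
    (hε₀ : 0 < ε₀) (hS : IsOpen S) (hA : IsOpen A) (hΩ : IsOpen Ω) (hU : IsOpen U)
    (hV : IsOpen V) (hΩUV : Ω ⊆ U ×ˢ V) (hX : ContinuousOn X S) (hY : ContinuousOn Y A)
    (hg : IsDiffeoFlow X S U ε₀ g) (hh : IsDiffeoFlow Y A V ε₀ h) (hK : IsCompact K)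
    (hKΩ : K ⊆ Ω) : ∃ δ, 0 < δ ∧ δ ≤ ε₀ ∧ ∀ ε, |ε| < δ → K ⊆ staysIn Ω g h ε := by
  have hev : ∀ᶠ τ : ℝ in 𝓝 0, ∀ p ∈ K, (g τ p.1, h τ p.2) ∈ Ω := by
    refine hK.eventually_forall_of_forall_eventually fun p hp => ?_
    obtain ⟨hs, ha⟩ := hΩUV (hKΩ hp)
    have hgc := ContinuousAt.comp (f := fun z : ℝ × E d × E m => (z.1, z.2.1)) (x := (0, p))
      (hg.continuousAt_zero hε₀ hS hU hX hs) (by fun_prop)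
    have hhc := ContinuousAt.comp (f := fun z : ℝ × E d × E m => (z.1, z.2.2)) (x := (0, p))
      (hh.continuousAt_zero hε₀ hA hV hY ha) (by fun_prop)
    refine (hgc.prodMk hhc).eventually_mem (hΩ.mem_nhds ?_)
    simpa [hg.zero _ hs, hh.zero _ ha] using hKΩ hp
  obtain ⟨δ, hδ, hball⟩ := Metric.eventually_nhds_iff_ball.1 hev
  refine ⟨min δ ε₀, lt_min hδ hε₀, min_le_right _ _, fun ε hε p hp => ⟨hKΩ hp, fun τ hτ =>
    hball τ ?_ p hp⟩⟩
  have h1 : |τ| ≤ |ε| := by simpa using abs_sub_left_of_mem_uIcc hτ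
  simpa using h1.trans_lt (hε.trans_le (min_le_left _ _))

theorem ControlledDiffusion.ExactValuePreservingOn.mono {d m q : ℕ}
    {D : ControlledDiffusion d m q} {S : Set (E d)} {W W' : Set (E d × E m)} {φ : E d → E d}
    {ψ : E m → E m} (hW : D.ExactValuePreservingOn S W φ ψ) (h : W' ⊆ W) :
    D.ExactValuePreservingOn S W' φ ψ :=
  ⟨fun f hf p hp => hW.1 f hf p (h hp), fun p hp => hW.2 p (h hp)⟩

end VPS

end

theorem mainTheorem4 {d m q : ℕ} (D : VPS.ControlledDiffusion d m q)
    (S U : Set (VPS.E d)) (A V : Set (VPS.E m)) (Ω : Set (VPS.E d × VPS.E m))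
    (hS : IsOpen S) (hA : IsOpen A) (hΩ : IsOpen Ω)
    (hU : IsOpen U) (hV : IsOpen V) (hUS : U ⊆ S) (hVA : V ⊆ A) (hΩUV : Ω ⊆ U ×ˢ V)
    (hD : D.SmoothOn S A)
    (X : VPS.E d → VPS.E d) (Y : VPS.E m → VPS.E m)
    (hX : ContDiffOn ℝ ∞ X S) (hY : ContDiffOn ℝ ∞ Y A)
    (hdet : D.DeterminingEqsOn X Y Ω)
    (ε₀ : ℝ) (hε₀ : 0 < ε₀)
    (g : ℝ → VPS.E d → VPS.E d) (h : ℝ → VPS.E m → VPS.E m)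
    (hg : VPS.IsDiffeoFlow X S U ε₀ g) (hh : VPS.IsDiffeoFlow Y A V ε₀ h) :
    -- for every `|ε| < ε₀`, at all points of `Ω` whose orbit up to time `ε` stays in `Ω`
    (∀ ε, |ε| < ε₀ →
      D.ExactValuePreservingOn S (VPS.staysIn Ω g h ε) (g ε) (h ε)) ∧
    -- on every compact subset of `Ω`, for all small `ε`
    (∀ K : Set (VPS.E d × VPS.E m), IsCompact K → K ⊆ Ω →
      ∃ δ, 0 < δ ∧ δ ≤ ε₀ ∧ ∀ ε, |ε| < δ → D.ExactValuePreservingOn S K (g ε) (h ε)) ∧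
    -- on all of `Ω` for every `|ε| < ε₀`, if the flows map `Ω` into itself
    ((∀ ε, |ε| < ε₀ → ∀ p ∈ Ω, (g ε p.1, h ε p.2) ∈ Ω) →
      ∀ ε, |ε| < ε₀ → D.ExactValuePreservingOn S Ω (g ε) (h ε)) := by
  have main : ∀ ε, |ε| < ε₀ → D.ExactValuePreservingOn S (VPS.staysIn Ω g h ε) (g ε) (h ε) :=
    fun ε hε => VPS.ControlledDiffusion.exactValuePreservingOn_staysIn hS hA hU hΩUV hD hX hdet
      hg hh hε
  refine ⟨main, fun K hK hKΩ => ?_, fun hinv ε hε => (main ε hε).mono fun p hp => ⟨hp,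
    fun τ hτ => hinv τ ?_ p hp⟩⟩
  · obtain ⟨δ, hδ, hδε, hstay⟩ := VPS.exists_forall_mem_staysIn hε₀ hS hA hΩ hU hV hΩUV
      hX.continuousOn hY.continuousOn hg hh hK hKΩ
    exact ⟨δ, hδ, hδε, fun ε hε => (main ε (hε.trans_le hδε)).mono (hstay ε hε)⟩
  · have h1 : |τ| ≤ |ε| := by simpa using Set.abs_sub_left_of_mem_uIcc hτ
    exact h1.trans_lt hε
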